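/- Let $(\mathcal X,\lambda)$ be a measurable space with a $\sigma$-finite reference measure (for example a measurable subset of $\mathbb R^d$ with Lebesgue measure, written $\mathsf d\theta$), let $\pi(\theta)$ be a probability density with respect to $\lambda$, and let $q(\theta'\mid\theta)$ be a jointly measurable proposal density with respect to $\lambda$. For each $\theta$ let $\widetilde q_\theta(\mathsf d w)$ be a probability law on $[0,\infty)$, depending measurably on $\theta$ (the law of the multiplicative noise, which may depend on $\theta$), with $\int w\,\widetilde q_\theta(\mathsf d w)=1$ for $\pi$-almost every $\theta$, and put $\nu_\theta(\mathsf d w)=w\,\widetilde q_\theta(\mathsf d w)$ and $\mu(\mathsf d\theta,\mathsf d w)=\pi(\theta)\,\nu_\theta(\mathsf d w)\,\mathsf d\theta$. Write $$r(\theta,\theta')=\frac{\pi(\theta')q(\theta\mid\theta')}{\pi(\theta)q(\theta'\mid\theta)},\qquad r(\theta)=\int q(\theta'\mid\theta)\,r(\theta,\theta')\,\mathsf d\theta' .$$ The pseudo-marginal Metropolis--Hastings kernel $P_{\mathrm{pm}}$ on $\mathcal X\times[0,\infty)$ proposes, from $(\theta,w)$, a pair $(\theta',w')$ with $\theta'\sim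 q(\cdot\mid\theta)$ and $w'\sim\widetilde q_{\theta'}$, moves there with probability $1\wedge\{r(\theta,\theta')w'/w\}$, and otherwise stays at $(\theta,w)$. Its left spectral gap is $$\epsilon^{L}=1+\inf\Big\{\iint f(x)f(y)\,\mu(\mathsf d x)P_{\mathrm{pm}}(x,\mathsf d y)\;:\; f\in L^2(\mu),\ \int f\,\mathsf d\mu=0,\ \int f^2\,\mathsf d\mu=1\Big\}.$$ Theorem 2. Suppose $\epsilon^{L}>0$. Let $h\in L^2(\mu)$ with $\int h\,\mathsf d\mu=0$, and let $(X_i)_{i\ge1}$ be a Markov chain with kernel $P_{\mathrm{pm}}$ and $X_1\sim\mu$. Then the asymptotic variance $$\mathsf{Var}_{P_{\mathrm{pm}}}(h)=\lim_{n\to\infty} n\,\mathrm{Var}\Big(\frac1n\sum_{i=1}^n h(X_i)\Big)$$ exists in $[0,\infty]$, and $$\mathsf{Var}_{P_{\mathrm{pm}}}(h)\ \ge\ \Big\{-\frac1{\epsilon^{L}}+\frac{\epsilon^{L}}{4-2\epsilon^{L}}\Big\}\int h^2\,\mathsf d\mu\;+\;\frac12\int\!\!\int \pi(\theta)\,h(\theta,w)^2\,\frac{w^2}{r(\theta)}\,\widetilde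 q_\theta(\mathsf d w)\,\mathsf d\theta ,$$ where the last integral may be $+\infty$ (with $w^2/0=\infty$ for $w>0$, and $0/0=0$); in the degenerate case $\epsilon^{L}=2$ the term $\epsilon^{L}/(4-2\epsilon^{L})$ is read as $0$. -/

import Mathlib

open MeasureTheory ProbabilityTheory Filter Topology
open scoped ENNReal NNReal

/-! ### Markov chains: stationary law, asymptotic variance, left spectral gap -/

section MarkovChains

variable {S : Type*} [MeasurableSpace S]

/-- The law, on the space of paths `ℕ → S`, of the time-homogeneous Markov chain
with initial law `μ` and transition kernel `P`. -/
noncomputable def chainLaw (P : Kernel S S) [IsMarkovKernel P] (μ : Measure S) :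
    Measure (ℕ → S) :=
  Kernel.trajMeasure (X := fun _ => S) μ
    (fun n => P.comap (fun x => x ⟨n, Finset.mem_Iic.2 le_rfl⟩) (measurable_pi_apply _))

/-- `n * Var ((1 / n) * ∑_{i < n} h (X_i))` for the chain with kernel `P` and `X_0 ∼ μ`. -/
noncomputable def scaledVariance (P : Kernel S S) [IsMarkovKernel P] (μ : Measure S)
    (h : S → ℝ) (n : ℕ) : ℝ≥0∞ :=
  n * eVar[fun x : ℕ → S => (1 / (n : ℝ)) * ∑ i ∈ Finset.range n, h (x i); chainLaw P μ]

/-- `V ∈ [0, ∞]` is the asymptotic variance of `h` for the chain with kernel `P` started from `μ`: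
the limit of `n * Var ((1 / n) * ∑_{i < n} h (X_i))` exists and equals `V`. -/
def HasAsymptoticVariance (P : Kernel S S) [IsMarkovKernel P] (μ : Measure S)
    (h : S → ℝ) (V : ℝ≥0∞) : Prop :=
  Tendsto (fun n => scaledVariance P μ h n) atTop (𝓝 V)

/-- The left spectral gap `1 + inf ∬ f(x) f(y) μ(dx) P(x, dy)`, the infimum being over
`f ∈ L²(μ)` with mean zero and norm one. -/
noncomputable def leftSpectralGap (P : Kernel S S) (μ : Measure S) : ℝ :=
  1 + sInf {c : ℝ | ∃ f : S → ℝ, MemLp f 2 μ ∧ ∫ x, f x ∂μ = 0 ∧ ∫ x, f x ^ 2 ∂μ = 1 ∧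
    c = ∫ z, f z.1 * f z.2 ∂(μ ⊗ₘ P)}

/-- The Metropolis-Hastings kernel which, from `x`, proposes `y ∼ K x`, moves to `y` with
probability `α x y`, and otherwise stays at `x`. -/
noncomputable def mhKernel (K : Kernel S S) [IsSFiniteKernel K] (α : S → S → ℝ≥0∞) :
    Kernel S S :=
  K.withDensity α + Kernel.id.withDensity (fun x _ => 1 - ∫⁻ y, α x y ∂(K x))

theorem isMarkovKernel_mhKernel (K : Kernel S S) [IsMarkovKernel K] (α : S → S → ℝ≥0∞)
    (hα : Measurable (Function.uncurry α)) (hle : ∀ x y, α x y ≤ 1) :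
    IsMarkovKernel (mhKernel K α) := by
  have hm : Measurable (fun x => ∫⁻ y, α x y ∂(K x)) := hα.lintegral_kernel_prod_right
  refine ⟨fun x => ⟨?_⟩⟩
  have hx : ∫⁻ y, α x y ∂(K x) ≤ 1 := by
    calc ∫⁻ y, α x y ∂(K x) ≤ ∫⁻ _, 1 ∂(K x) := lintegral_mono (fun y => hle x y)
      _ = 1 := by simp
  have hm' : Measurable (Function.uncurry
      (fun (x : S) (_ : S) => 1 - ∫⁻ y, α x y ∂(K x))) := by
    exact (measurable_const.sub hm).comp measurable_fst
  rw [mhKernel, FunLike.coe_add, Pi.add_apply, Measure.add_apply,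
    Kernel.withDensity_apply' _ hα, Kernel.withDensity_apply' _ hm']
  simp [add_tsub_cancel_of_le hx]

end MarkovChains

/-! ### The pseudo-marginal Metropolis-Hastings algorithm -/

/-- The data of a pseudo-marginal Metropolis-Hastings algorithm on a parameter space `Θ` with
reference measure `ref`: the posterior density, the proposal densities, and the law of the
multiplicative noise at each parameter value. -/
structure PseudoMarginal {Θ : Type*} [MeasurableSpace Θ] (ref : Measure Θ) where
  /-- The posterior density `π(θ)` with respect to `ref`. -/
  post : Θ → ℝ≥0
  measurable_post : Measurable post
  lintegral_post : ∫⁻ θ, (post θ : ℝ≥0∞) ∂ref = 1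
  /-- The proposal density: `q θ θ'` is `q(θ' | θ)`, a density in `θ'` with respect to `ref`. -/
  q : Θ → Θ → ℝ≥0
  measurable_q : Measurable (Function.uncurry q)
  lintegral_q : ∀ θ, ∫⁻ θ', (q θ θ' : ℝ≥0∞) ∂ref = 1
  /-- The law on `[0, ∞)` of the proposed multiplicative noise at `θ`; it may depend on `θ`. -/
  noise : Kernel Θ ℝ≥0
  isMarkovKernel_noise : IsMarkovKernel noise
  /-- The noise is unbiased at `π`-almost every parameter value. -/
  lintegral_noise : ∀ᵐ θ ∂(ref.withDensity fun θ => (post θ : ℝ≥0∞)),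
    ∫⁻ w, (w : ℝ≥0∞) ∂(noise θ) = 1

namespace PseudoMarginal

variable {Θ : Type*} [MeasurableSpace Θ] {ref : Measure Θ} (M : PseudoMarginal ref)

instance : IsMarkovKernel M.noise := M.isMarkovKernel_noise

/-- The posterior distribution `π(dθ)`. -/
noncomputable def target : Measure Θ := ref.withDensity fun θ => (M.post θ : ℝ≥0∞)

instance : IsProbabilityMeasure M.target :=
  ⟨by rw [target, withDensity_apply _ MeasurableSet.univ, Measure.restrict_univ,
    M.lintegral_post]⟩

/-- The measure `π(dθ) q̃_θ(dw)`, where `q̃_θ` is the law of the proposed noise at `θ`. -/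
noncomputable def joint : Measure (Θ × ℝ≥0) := M.target ⊗ₘ M.noise

instance : IsProbabilityMeasure M.joint := by
  unfold joint; infer_instance

/-- The measure `π(dθ) ν_θ(dw)`, where `ν_θ(dw) = w q̃_θ(dw)`: the stationary distribution of
the pseudo-marginal chain. -/
noncomputable def stationary : Measure (Θ × ℝ≥0) :=
  M.joint.withDensity fun x => (x.2 : ℝ≥0∞)

instance : IsProbabilityMeasure M.stationary := by
  refine ⟨?_⟩
  have hm : Measurable fun x : Θ × ℝ≥0 => (x.2 : ℝ≥0∞) := by fun_prop
  rw [stationary, withDensity_apply _ MeasurableSet.univ, Measure.restrict_univ, joint,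
    Measure.lintegral_compProd hm,
    lintegral_congr_ae (μ := M.target) (g := fun _ => 1) M.lintegral_noise]
  simp

/-- The ratio `r(θ, θ') = π(θ') q(θ | θ') / (π(θ) q(θ' | θ))`. -/
noncomputable def ratio (θ θ' : Θ) : ℝ≥0∞ :=
  ((M.post θ' : ℝ≥0∞) * M.q θ' θ) / ((M.post θ : ℝ≥0∞) * M.q θ θ')

theorem measurable_ratio : Measurable (Function.uncurry M.ratio) := by
  have h1 := M.measurable_post
  have h2 : Measurable fun p : Θ × Θ => M.q p.1 p.2 := M.measurable_q
  have h3 : Measurable fun p : Θ × Θ => M.q p.2 p.1 := h2.comp measurable_swap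
  unfold Function.uncurry ratio
  fun_prop

/-- The acceptance probability `1 ∧ (r(θ, θ') w' / w)` of the pseudo-marginal chain. -/
noncomputable def accept (x y : Θ × ℝ≥0) : ℝ≥0∞ :=
  min 1 (M.ratio x.1 y.1 * ((y.2 : ℝ≥0∞) / x.2))

theorem measurable_accept : Measurable (Function.uncurry M.accept) := by
  have h1 : Measurable fun p : (Θ × ℝ≥0) × (Θ × ℝ≥0) => M.ratio p.1.1 p.2.1 :=
    M.measurable_ratio.comp (by fun_prop : Measurable
      fun p : (Θ × ℝ≥0) × (Θ × ℝ≥0) => (p.1.1, p.2.1))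
  unfold Function.uncurry accept
  fun_prop

variable [SigmaFinite ref]

/-- The proposal `q(θ' | θ) dθ'` for the parameter. -/
noncomputable def propose : Kernel Θ Θ :=
  (Kernel.const Θ ref).withDensity fun θ θ' => (M.q θ θ' : ℝ≥0∞)

instance : IsMarkovKernel M.propose := by
  refine ⟨fun θ => ⟨?_⟩⟩
  rw [propose, Kernel.withDensity_apply' _ M.measurable_q.coe_nnreal_ennreal]
  simp [M.lintegral_q]

/-- The proposal `q(θ' | θ) dθ' q̃_{θ'}(dw')` of the pseudo-marginal chain from `(θ, w)`. -/
noncomputable def pmPropose : Kernel (Θ × ℝ≥0) (Θ × ℝ≥0) :=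
  (M.propose ⊗ₖ M.noise.prodMkLeft Θ).comap Prod.fst measurable_fst

instance : IsMarkovKernel M.pmPropose := by
  unfold pmPropose; infer_instance

/-- The pseudo-marginal Metropolis-Hastings kernel `P_pm`. -/
noncomputable def pmKernel : Kernel (Θ × ℝ≥0) (Θ × ℝ≥0) := mhKernel M.pmPropose M.accept

instance : IsMarkovKernel M.pmKernel :=
  isMarkovKernel_mhKernel _ _ M.measurable_accept fun _ _ => min_le_left _ _

/-- `r(θ) = E[r(θ, θ')]`, the expectation being over `θ' ∼ q(· | θ)`. -/
noncomputable def meanRatio (θ : Θ) : ℝ≥0∞ := ∫⁻ θ', M.ratio θ θ' ∂(M.propose θ)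

end PseudoMarginal

/-! ### Cesàro means of sequences tending to infinity -/

/-! Let `T` be the transition operator on `L²(μ)`. Detailed balance makes it a symmetric
contraction, and the scaled variances are Cesàro means of `2 ∑_{k ≤ j} ⟪h, T ^ k h⟫ - ‖h‖²`. The gap
replaces spectral calculus: lags `2k` and `2k + 1` together contribute at least `ε ‖T ^ k h‖²`, so
either these squares are summable and the autocovariance series converges, or it diverges to
infinity (`tendsto_sum_autocov`). In the first case, completing the square gives, for every `g` in
`L²(μ)`, centred or not, `V ≥ 4 ⟪g, h⟫ - ∬ (g x - g y)² μ(dx) P(x, dy) - ‖h‖²`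
(`exists_hasAsymptoticVariance`).

Two choices of `g` suffice. The acceptance probability at `(θ, w)` is at most `1 / s` with `s = 1 ∨
(w / r(θ))`, so the Dirichlet form of `g` is at most `4 ∫ g² / s`; taking `g = h s / 2`, truncated,
gives `V ≥ ∫ h² s - ∫ h²`. The gap bounds the Dirichlet form of `h` by `2 (2 - ε) ∫ h²`, so `g = h /
(2 - ε)` gives `V ≥ ε / (2 - ε) ∫ h²`. For `ε < 2` the average of the two bounds, with `w / r ≤ s`
and `1 / 2 ≤ 1 / ε`, is the claim; for `ε = 2` the first alone is enough. -/

theorem tendsto_cesaro_atTop {u : ℕ → ℝ} (hu : Tendsto u atTop atTop) :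
    Tendsto (fun n : ℕ => (n : ℝ)⁻¹ * ∑ i ∈ Finset.range n, u i) atTop atTop := by
  refine tendsto_atTop.2 fun B => ?_
  obtain ⟨N, hN⟩ := eventually_atTop.1 (tendsto_atTop.1 hu (B + 1))
  -- The deficit of the first `N` terms against the level `B + 1` is fixed; divided by `n` it
  -- eventually costs less than the spare `1`.
  set C := ∑ i ∈ Finset.range N, (u i - (B + 1)) with hC
  have hlim : Tendsto (fun n : ℕ => C / (n : ℝ)) atTop (𝓝 0) :=
    tendsto_const_div_atTop_nhds_zero_nat C
  filter_upwards [eventually_ge_atTop N, eventually_gt_atTop 0,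
    hlim.eventually (lt_mem_nhds (show (-1 : ℝ) < 0 by norm_num))] with n hn hn0 hCn
  have hn0' : (0 : ℝ) < n := by exact_mod_cast hn0
  have h1 : C ≤ ∑ i ∈ Finset.range n, (u i - (B + 1)) := by
    rw [hC]
    refine Finset.sum_le_sum_of_subset_of_nonneg (Finset.range_subset_range.2 hn) ?_
    intro i _ hi
    have := hN i (by simpa using hi)
    linarith
  rw [Finset.sum_sub_distrib, Finset.sum_const, Finset.card_range, nsmul_eq_mul] at h1
  rw [lt_div_iff₀ hn0'] at hCn
  rw [inv_mul_eq_div, le_div_iff₀ hn0']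
  nlinarith

/-! ### Autocovariances of a symmetric contraction -/

section SymmetricContraction

variable {E : Type*} [NormedAddCommGroup E] [InnerProductSpace ℝ E] {T : E →L[ℝ] E}

local notation "⟪" x ", " y "⟫" => inner ℝ x y

theorem inner_pow_apply_symm (hT : ∀ x y, ⟪T x, y⟫ = ⟪x, T y⟫) (k : ℕ) (x y : E) :
    ⟪(T ^ k) x, y⟫ = ⟪x, (T ^ k) y⟫ := by
  induction k generalizing x y with
  | zero => simp
  | succ k ih =>
    rw [pow_succ, mul_apply_eq_comp, ih, hT, ← mul_apply_eq_comp,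
      ← pow_succ', pow_succ]

theorem inner_pow_add_apply (hT : ∀ x y, ⟪T x, y⟫ = ⟪x, T y⟫) (j k : ℕ) (x y : E) :
    ⟪(T ^ j) x, (T ^ k) y⟫ = ⟪x, (T ^ (j + k)) y⟫ := by
  rw [inner_pow_apply_symm hT, pow_add, mul_apply_eq_comp]

theorem inner_pow_two_mul (hT : ∀ x y, ⟪T x, y⟫ = ⟪x, T y⟫) (k : ℕ) (x : E) :
    ⟪x, (T ^ (2 * k)) x⟫ = ‖(T ^ k) x‖ ^ 2 := by
  rw [two_mul, ← inner_pow_add_apply hT, real_inner_self_eq_norm_sq]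

theorem inner_pow_two_mul_add_one (hT : ∀ x y, ⟪T x, y⟫ = ⟪x, T y⟫) (k : ℕ) (x : E) :
    ⟪x, (T ^ (2 * k + 1)) x⟫ = ⟪(T ^ k) x, T ((T ^ k) x)⟫ := by
  rw [two_mul, add_assoc, ← inner_pow_add_apply hT, pow_succ', mul_apply_eq_comp]

/-- Pair lag `2k` with lag `2k + 1`: their sum is `⟪y, y + T y⟫` at `y = T ^ k h`, which is where
the gap applies. -/
theorem sum_autocov_ge (hT : ∀ x y, ⟪T x, y⟫ = ⟪x, T y⟫) {h : E} {ε : ℝ}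
    (hgap : ∀ k, ε * ‖(T ^ k) h‖ ^ 2 ≤ ‖(T ^ k) h‖ ^ 2 + ⟪(T ^ k) h, T ((T ^ k) h)⟫) (m : ℕ) :
    ε * ∑ k ∈ Finset.range m, ‖(T ^ k) h‖ ^ 2 ≤
      ∑ k ∈ Finset.range (2 * m), ⟪h, (T ^ k) h⟫ := by
  induction m with
  | zero => simp
  | succ m ih =>
    rw [Finset.sum_range_succ, mul_add 2, mul_one, Finset.sum_range_succ, Finset.sum_range_succ,
      inner_pow_two_mul hT, inner_pow_two_mul_add_one hT]
    linarith [hgap m]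

theorem sum_autocov_ge_half (hT : ∀ x y, ⟪T x, y⟫ = ⟪x, T y⟫) {h : E} {ε : ℝ}
    (hgap : ∀ k, ε * ‖(T ^ k) h‖ ^ 2 ≤ ‖(T ^ k) h‖ ^ 2 + ⟪(T ^ k) h, T ((T ^ k) h)⟫) (n : ℕ) :
    ε * ∑ k ∈ Finset.range (n / 2), ‖(T ^ k) h‖ ^ 2 ≤
      ∑ k ∈ Finset.range n, ⟪h, (T ^ k) h⟫ := by
  refine (sum_autocov_ge hT hgap (n / 2)).trans ?_
  rcases Nat.even_or_odd' n with ⟨m, rfl | rfl⟩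
  · simp
  -- An odd number of terms leaves one unpaired even lag, a squared norm.
  · have : (2 * m + 1) / 2 = m := by omega
    rw [this, Finset.sum_range_succ, inner_pow_two_mul hT]
    linarith [sq_nonneg ‖(T ^ m) h‖]

/-- Even lags are the squares `‖T ^ k h‖²`, and contractivity dominates each odd lag by the
preceding even one. -/
theorem summable_autocov (hT : ∀ x y, ⟪T x, y⟫ = ⟪x, T y⟫) (hnorm : ∀ x, ‖T x‖ ≤ ‖x‖) {h : E}
    (hs : Summable fun k => ‖(T ^ k) h‖ ^ 2) : Summable fun k => ⟪h, (T ^ k) h⟫ := by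
  have he : Summable fun k => ⟪h, (T ^ (2 * k)) h⟫ := by
    simpa only [inner_pow_two_mul hT] using hs
  have ho : Summable fun k => ⟪h, (T ^ (2 * k + 1)) h⟫ := by
    refine Summable.of_norm_bounded hs fun k => ?_
    rw [inner_pow_two_mul_add_one hT, sq]
    exact (norm_inner_le_norm _ _).trans (by gcongr; exact hnorm _)
  exact (HasSum.even_add_odd (f := fun k => ⟪h, (T ^ k) h⟫) he.hasSum ho.hasSum).summable

theorem apply_sum_pow_eq (n : ℕ) (h : E) :
    (∑ k ∈ Finset.range n, (T ^ k) h) - T (∑ k ∈ Finset.range n, (T ^ k) h) =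
      h - (T ^ n) h := by
  induction n with
  | zero => simp
  | succ n ih =>
    rw [Finset.sum_range_succ, map_add, add_sub_add_comm, ih, pow_succ',
      mul_apply_eq_comp]
    abel

theorem inner_sub_apply_nonneg (hnorm : ∀ x, ‖T x‖ ≤ ‖x‖) (x : E) : 0 ≤ ⟪x, x - T x⟫ := by
  rw [inner_sub_right, real_inner_self_eq_norm_sq]
  have := (real_inner_le_norm x (T x)).trans
    (mul_le_mul_of_nonneg_left (hnorm x) (norm_nonneg x))
  nlinarith

/-- The variational lower bound for `∑ ⟪h, T ^ k h⟫`. -/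
theorem two_mul_inner_sub_le_of_tendsto (hT : ∀ x y, ⟪T x, y⟫ = ⟪x, T y⟫)
    (hnorm : ∀ x, ‖T x‖ ≤ ‖x‖) {h : E} (hs : Summable fun k => ‖(T ^ k) h‖ ^ 2) {L : ℝ}
    (hL : Tendsto (fun n => ∑ k ∈ Finset.range n, ⟪h, (T ^ k) h⟫) atTop (𝓝 L)) (g : E) :
    2 * ⟪g, h⟫ - ⟪g, g - T g⟫ ≤ L := by
  set R : ℕ → E := fun n => ∑ k ∈ Finset.range n, (T ^ k) h with hR
  set s : ℕ → ℝ := fun n => ∑ k ∈ Finset.range n, ⟪h, (T ^ k) h⟫ with hsdef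
  have hRh (n : ℕ) : ⟪R n, h⟫ = s n := by
    simp only [hR, hsdef, sum_inner]
    exact Finset.sum_congr rfl fun k _ => inner_pow_apply_symm hT _ _ _
  have hRT (n : ℕ) : ⟪R n, (T ^ n) h⟫ = s (n + n) - s n := by
    simp only [hR, hsdef, sum_inner, Finset.sum_range_add, add_sub_cancel_left]
    exact Finset.sum_congr rfl fun k _ => by rw [inner_pow_add_apply hT, add_comm]
  have key (n : ℕ) :
      0 ≤ ⟪g, g - T g⟫ - 2 * ⟪g, h⟫ + 2 * ⟪g, (T ^ n) h⟫ + (s n - (s (n + n) - s n)) := by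
    -- The supremum over `g` is formally attained at `(1 - T)⁻¹ h`, approximated by `R n` because
    -- `(1 - T) (R n) = h - T ^ n h`. Positivity of the form at `g - R n` is the completed square;
    -- the error terms vanish as `n → ∞`.
    have h0 := inner_sub_apply_nonneg hnorm (g - R n)
    have h1 : g - R n - T (g - R n) = (g - T g) - (h - (T ^ n) h) := by
      rw [← apply_sum_pow_eq n h, map_sub]; abel
    have h2 : ⟪R n, g - T g⟫ = ⟪g, h - (T ^ n) h⟫ := by
      rw [inner_sub_right, ← hT, ← inner_sub_left, apply_sum_pow_eq, real_inner_comm]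
    rw [h1, inner_sub_right, inner_sub_left, inner_sub_left, h2, inner_sub_right (R n), hRh, hRT,
      inner_sub_right g h] at h0
    linarith
  have hT0 : Tendsto (fun n => (T ^ n) h) atTop (𝓝 0) := by
    have h1 := (hs.tendsto_atTop_zero).sqrt
    simp only [Real.sqrt_sq (norm_nonneg _), Real.sqrt_zero] at h1
    exact tendsto_zero_iff_norm_tendsto_zero.2 h1
  have hg0 : Tendsto (fun n => ⟪g, (T ^ n) h⟫) atTop (𝓝 0) := by
    simpa using (tendsto_const_nhds (x := g)).inner (𝕜 := ℝ) hT0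
  have hL2 : Tendsto (fun n => s (n + n)) atTop (𝓝 L) :=
    hL.comp (tendsto_atTop_mono (fun n => Nat.le_add_left n n) tendsto_id)
  have hlim := ge_of_tendsto' ((((tendsto_const_nhds (x := ⟪g, g - T g⟫ - 2 * ⟪g, h⟫)).add
    (hg0.const_mul 2)).add (hL.sub (hL2.sub hL)))) key
  linarith

/-- If `1 + T` is bounded below along the orbit of `h`, then `∑ ⟪h, T ^ k h⟫` either converges to
a limit satisfying the variational lower bound, or diverges to infinity. -/
theorem tendsto_sum_autocov (hT : ∀ x y, ⟪T x, y⟫ = ⟪x, T y⟫) (hnorm : ∀ x, ‖T x‖ ≤ ‖x‖)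
    {h : E} {ε : ℝ} (hε : 0 < ε)
    (hgap : ∀ k, ε * ‖(T ^ k) h‖ ^ 2 ≤ ‖(T ^ k) h‖ ^ 2 + ⟪(T ^ k) h, T ((T ^ k) h)⟫) :
    (∃ L, Tendsto (fun n => ∑ k ∈ Finset.range n, ⟪h, (T ^ k) h⟫) atTop (𝓝 L) ∧
      ∀ g, 2 * ⟪g, h⟫ - ⟪g, g - T g⟫ ≤ L) ∨
    Tendsto (fun n => ∑ k ∈ Finset.range n, ⟪h, (T ^ k) h⟫) atTop atTop := by
  by_cases hs : Summable fun k => ‖(T ^ k) h‖ ^ 2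
  · have hL := (summable_autocov hT hnorm hs).hasSum.tendsto_sum_nat
    exact Or.inl ⟨_, hL, two_mul_inner_sub_le_of_tendsto hT hnorm hs hL⟩
  · right
    rw [not_summable_iff_tendsto_nat_atTop_of_nonneg fun _ => sq_nonneg _] at hs
    refine tendsto_atTop_mono (sum_autocov_ge_half hT hgap) ?_
    exact (hs.comp (Nat.tendsto_div_const_atTop two_ne_zero)).const_mul_atTop hε

end SymmetricContraction

theorem integral_comp_measurePreserving {Ω S : Type*} [MeasurableSpace Ω] [MeasurableSpace S]
    {ν : Measure Ω} {μ : Measure S} {φ : Ω → S} (hφ : MeasurePreserving φ ν μ) {f : S → ℝ}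
    (hf : AEStronglyMeasurable f μ) : ∫ x, f (φ x) ∂ν = ∫ y, f y ∂μ := by
  conv_rhs => rw [← hφ.map_eq]
  rw [integral_map hφ.measurable.aemeasurable (by rwa [hφ.map_eq])]

/-! ### The transition operator on `L²` -/

section TransitionOperator

variable {S : Type*} [MeasurableSpace S] {P : Kernel S S} [IsMarkovKernel P] {μ : Measure S}
  [IsProbabilityMeasure μ]

theorem measurePreserving_fst_compProd : MeasurePreserving Prod.fst (μ ⊗ₘ P) μ :=
  ⟨measurable_fst, Measure.fst_compProd μ P⟩

theorem measurePreserving_snd_compProd (hrev : (μ ⊗ₘ P).map Prod.swap = μ ⊗ₘ P) :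
    MeasurePreserving Prod.snd (μ ⊗ₘ P) μ :=
  measurePreserving_fst_compProd.comp ⟨measurable_swap, hrev⟩

/-- The operator `f ↦ ∫ f(y) P(x, dy)` on `L²(μ)`, for `μ` invariant under `P`. -/
noncomputable def transitionOp (hsnd : MeasurePreserving Prod.snd (μ ⊗ₘ P) μ) :
    Lp ℝ 2 μ →L[ℝ] Lp ℝ 2 μ :=
  (ContinuousLinearMap.adjoint (Lp.compMeasurePreservingₗᵢ ℝ (E := ℝ) (p := 2) Prod.fst
    (measurePreserving_fst_compProd (P := P) (μ := μ))).toContinuousLinearMap) ∘L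
    (Lp.compMeasurePreservingₗᵢ ℝ Prod.snd hsnd).toContinuousLinearMap

/-- Writing the operator as an adjoint isometry after an isometry turns its matrix coefficients into
integrals over the law of two consecutive states. Symmetry is then invariance of that law under the
swap. -/
theorem inner_transitionOp (hsnd : MeasurePreserving Prod.snd (μ ⊗ₘ P) μ) (f g : Lp ℝ 2 μ) :
    inner ℝ f (transitionOp hsnd g) = ∫ z, f z.1 * g z.2 ∂(μ ⊗ₘ P) := by
  rw [transitionOp, ContinuousLinearMap.comp_apply, ContinuousLinearMap.adjoint_inner_right,
    L2.inner_def]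
  refine integral_congr_ae ?_
  filter_upwards [Lp.coeFn_compMeasurePreserving f (measurePreserving_fst_compProd (P := P)),
    Lp.coeFn_compMeasurePreserving g hsnd] with z hf hg
  change inner ℝ (Lp.compMeasurePreserving Prod.fst _ f z) (Lp.compMeasurePreserving _ _ g z) = _
  rw [hf, hg]
  simp [mul_comm]

theorem transitionOp_symm (hsnd : MeasurePreserving Prod.snd (μ ⊗ₘ P) μ)
    (hrev : (μ ⊗ₘ P).map Prod.swap = μ ⊗ₘ P) (f g : Lp ℝ 2 μ) :
    inner ℝ (transitionOp hsnd f) g = inner ℝ f (transitionOp hsnd g) := by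
  rw [real_inner_comm, inner_transitionOp, inner_transitionOp]
  have hswap : MeasurePreserving (MeasurableEquiv.prodComm (α := S) (β := S))
      (μ ⊗ₘ P) (μ ⊗ₘ P) := ⟨measurable_swap, hrev⟩
  rw [← hswap.integral_comp' (fun z => f z.1 * g z.2)]
  exact integral_congr_ae (ae_of_all _ fun z => mul_comm _ _)

theorem norm_transitionOp_apply_le (hsnd : MeasurePreserving Prod.snd (μ ⊗ₘ P) μ)
    (f : Lp ℝ 2 μ) : ‖transitionOp hsnd f‖ ≤ ‖f‖ := by
  rw [transitionOp, ContinuousLinearMap.comp_apply]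
  refine (ContinuousLinearMap.le_opNorm _ _).trans ?_
  rw [LinearIsometryEquiv.norm_map]
  refine (mul_le_mul_of_nonneg_right (LinearIsometry.norm_toContinuousLinearMap_le _)
    (norm_nonneg _)).trans ?_
  rw [one_mul, LinearIsometry.coe_toContinuousLinearMap, LinearIsometry.norm_map]

theorem integrable_mul_compProd (hsnd : MeasurePreserving Prod.snd (μ ⊗ₘ P) μ) {f g : S → ℝ}
    (hf : MemLp f 2 μ) (hg : MemLp g 2 μ) :
    Integrable (fun z => f z.1 * g z.2) (μ ⊗ₘ P) :=
  (hf.comp_measurePreserving measurePreserving_fst_compProd).integrable_mul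
    (hg.comp_measurePreserving hsnd)

theorem integrable_integral_compProd {S' : Type*} [MeasurableSpace S'] {κ : Kernel S S'}
    {ν : Measure S} [SFinite ν] [IsSFiniteKernel κ] {f : S × S' → ℝ}
    (hf : Integrable f (ν ⊗ₘ κ)) : Integrable (fun x => ∫ y, f (x, y) ∂(κ x)) ν := by
  rw [Measure.compProd] at hf
  simpa using hf.integral_compProd

/-- Tested against indicators, the operator agrees with averaging over the kernel. This links the
Hilbert space operator to the path law. -/
theorem coeFn_transitionOp (hsnd : MeasurePreserving Prod.snd (μ ⊗ₘ P) μ) (g : Lp ℝ 2 μ) :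
    transitionOp hsnd g =ᵐ[μ] fun x => ∫ y, g y ∂(P x) := by
  have hint : Integrable (fun z : S × S => g z.2) (μ ⊗ₘ P) :=
    ((Lp.memLp g).comp_measurePreserving hsnd).integrable one_le_two
  refine ae_eq_of_forall_setIntegral_eq_of_sigmaFinite
    (fun s _ _ => ((Lp.memLp _).integrable one_le_two).integrableOn)
    (fun s _ _ => (integrable_integral_compProd hint).integrableOn) fun s hs hμs => ?_
  rw [← L2.inner_indicatorConstLp_one (𝕜 := ℝ) hs hμs.ne, inner_transitionOp,
    ← integral_indicator hs]
  have hfst : (fun z : S × S => indicatorConstLp 2 hs hμs.ne (1 : ℝ) z.1) =ᵐ[μ ⊗ₘ P]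
      fun z => s.indicator (fun _ => (1 : ℝ)) z.1 :=
    (measurePreserving_fst_compProd (P := P)).quasiMeasurePreserving.ae_eq_comp
      indicatorConstLp_coeFn
  rw [integral_congr_ae (g := fun z => s.indicator (fun _ => (1 : ℝ)) z.1 * g z.2)
    (hfst.mul (ae_eq_refl _)), Measure.integral_compProd]
  · refine integral_congr_ae (ae_of_all _ fun x => ?_)
    by_cases hx : x ∈ s <;> simp [hx]
  · refine integrable_mul_compProd hsnd ?_ (Lp.memLp g)
    exact memLp_indicator_const 2 hs 1 (Or.inr hμs.ne)

end TransitionOperator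

/-! ### Covariances along a stationary chain -/

section Covariance

variable {S : Type*} [MeasurableSpace S] (P : Kernel S S) [IsMarkovKernel P] {μ : Measure S}
  [IsProbabilityMeasure μ]

instance : IsProbabilityMeasure (chainLaw P μ) := by
  unfold chainLaw; infer_instance

theorem chainLaw_map_frestrictLe_compProd (n : ℕ) :
    (chainLaw P μ).map (Preorder.frestrictLe n) ⊗ₘ
      (P.comap (fun x : (i : Finset.Iic n) → S => x ⟨n, Finset.mem_Iic.2 le_rfl⟩)
        (measurable_pi_apply _)) =
      (chainLaw P μ).map (fun x => (Preorder.frestrictLe n x, x (n + 1))) :=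
  Kernel.map_frestrictLe_trajMeasure_compProd_eq_map_trajMeasure

theorem chainLaw_map_eval_zero (μ : Measure S) : (chainLaw P μ).map (fun x => x 0) = μ := by
  have h : (fun x : ℕ → S => x 0) =
      (fun x : (i : Finset.Iic 0) → S => x ⟨0, Finset.mem_Iic.2 le_rfl⟩) ∘
        Preorder.frestrictLe 0 := rfl
  rw [h, ← Measure.map_map (by fun_prop) (by fun_prop), chainLaw, Kernel.trajMeasure,
    Measure.map_comp _ _ (by fun_prop), Kernel.traj_map_frestrictLe, Kernel.partialTraj_self,
    Measure.id_comp, Measure.map_map (by fun_prop) (by fun_prop)]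
  exact Measure.map_id

theorem chainLaw_map_pair (n : ℕ) :
    (chainLaw P μ).map (fun x => (x n, x (n + 1))) =
      (chainLaw P μ).map (fun x => x n) ⊗ₘ P := by
  have hn : Measurable fun x : (i : Finset.Iic n) → S => x ⟨n, Finset.mem_Iic.2 le_rfl⟩ :=
    measurable_pi_apply _
  have h : (fun x : ℕ → S => (x n, x (n + 1))) =
      (Prod.map (fun x : (i : Finset.Iic n) → S => x ⟨n, Finset.mem_Iic.2 le_rfl⟩) id) ∘
        (fun x => (Preorder.frestrictLe n x, x (n + 1))) := rfl
  rw [h, ← Measure.map_map (by fun_prop) (by fun_prop), ← chainLaw_map_frestrictLe_compProd]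
  have h' : (fun x : ℕ → S => x n) =
      (fun x : (i : Finset.Iic n) → S => x ⟨n, Finset.mem_Iic.2 le_rfl⟩) ∘
        Preorder.frestrictLe n := rfl
  rw [h', ← Measure.map_map (by fun_prop) (by fun_prop)]
  have : IsProbabilityMeasure ((chainLaw P μ).map (Preorder.frestrictLe n)) :=
    Measure.isProbabilityMeasure_map (by fun_prop)
  ext s hs
  rw [Measure.map_apply (by fun_prop) hs,
    Measure.compProd_apply (hs.preimage (by fun_prop)), Measure.compProd_apply hs,
    lintegral_map (μ := (chainLaw P μ).map (Preorder.frestrictLe n))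
      (Kernel.measurable_kernel_prodMk_left hs) hn]
  rfl

variable {P}

theorem measurePreserving_eval (hsnd : MeasurePreserving Prod.snd (μ ⊗ₘ P) μ) (n : ℕ) :
    MeasurePreserving (fun x : ℕ → S => x n) (chainLaw P μ) μ := by
  induction n with
  | zero => exact ⟨by fun_prop, chainLaw_map_eval_zero P μ⟩
  | succ n ih =>
    refine ⟨by fun_prop, ?_⟩
    have h : (fun x : ℕ → S => x (n + 1)) = Prod.snd ∘ fun x => (x n, x (n + 1)) := rfl
    rw [h, ← Measure.map_map (by fun_prop) (by fun_prop), chainLaw_map_pair, ih.map_eq,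
      hsnd.map_eq]

/-- The Markov property: given the path up to `n`, the value `f (x i)` is known and the next state
has law `P (x n)`. -/
theorem integral_mul_eval_succ (hsnd : MeasurePreserving Prod.snd (μ ⊗ₘ P) μ) (f g : Lp ℝ 2 μ)
    {i n : ℕ} (hin : i ≤ n) :
    ∫ x, f (x i) * g (x (n + 1)) ∂(chainLaw P μ) =
      ∫ x, f (x i) * transitionOp hsnd g (x n) ∂(chainLaw P μ) := by
  set ν := (chainLaw P μ).map (Preorder.frestrictLe n) with hν
  have hfr : MeasurePreserving (Preorder.frestrictLe n) (chainLaw P μ) ν := ⟨by fun_prop, rfl⟩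
  have : IsProbabilityMeasure ν := Measure.isProbabilityMeasure_map (by fun_prop)
  have hpair : MeasurePreserving (fun x : ℕ → S => (Preorder.frestrictLe n x, x (n + 1)))
      (chainLaw P μ) (ν ⊗ₘ
      (P.comap (fun x : (i : Finset.Iic n) → S => x ⟨n, Finset.mem_Iic.2 le_rfl⟩)
        (measurable_pi_apply _))) :=
    ⟨by fun_prop, (chainLaw_map_frestrictLe_compProd P n).symm⟩
  set F : ((i : Finset.Iic n) → S) × S → ℝ :=
    fun z => f (z.1 ⟨i, Finset.mem_Iic.2 hin⟩) * g z.2 with hF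
  have hFmeas : StronglyMeasurable F :=
    ((Lp.stronglyMeasurable f).comp_measurable (by fun_prop)).mul
      ((Lp.stronglyMeasurable g).comp_measurable (by fun_prop))
  have hint : Integrable (fun x : ℕ → S => f (x i) * g (x (n + 1))) (chainLaw P μ) :=
    ((Lp.memLp f).comp_measurePreserving (measurePreserving_eval hsnd i)).integrable_mul
      ((Lp.memLp g).comp_measurePreserving (measurePreserving_eval hsnd (n + 1)))
  have hFint : Integrable F (ν ⊗ₘ
      (P.comap (fun x : (i : Finset.Iic n) → S => x ⟨n, Finset.mem_Iic.2 le_rfl⟩)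
        (measurable_pi_apply _))) :=
    (hpair.integrable_comp hFmeas.aestronglyMeasurable).1 hint
  have h1 : ∫ x, f (x i) * g (x (n + 1)) ∂(chainLaw P μ) = ∫ z, F z ∂(ν ⊗ₘ
      (P.comap (fun x : (i : Finset.Iic n) → S => x ⟨n, Finset.mem_Iic.2 le_rfl⟩)
        (measurable_pi_apply _))) := by
    rw [← hpair.map_eq, integral_map hpair.measurable.aemeasurable
      hFmeas.aestronglyMeasurable]
    rfl
  rw [h1, Measure.integral_compProd hFint, hν, integral_map hfr.measurable.aemeasurable]
  · refine integral_congr_ae ?_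
    filter_upwards [(measurePreserving_eval hsnd n).quasiMeasurePreserving.ae_eq_comp
      (coeFn_transitionOp hsnd g)] with x hx
    simp only [Function.comp_apply] at hx
    rw [hx, ← integral_const_mul]
    rfl
  · exact (integrable_integral_compProd hFint).aestronglyMeasurable

/-- The covariances of a stationary reversible chain are the matrix coefficients of the powers of
its transition operator. -/
theorem integral_mul_eval_add (hsnd : MeasurePreserving Prod.snd (μ ⊗ₘ P) μ) (f g : Lp ℝ 2 μ)
    (i k : ℕ) :
    ∫ x, f (x i) * g (x (i + k)) ∂(chainLaw P μ) = inner ℝ f ((transitionOp hsnd ^ k) g) := by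
  induction k generalizing g with
  | zero =>
    rw [pow_zero, one_apply_eq_self, L2.inner_def, ← integral_comp_measurePreserving
      (measurePreserving_eval hsnd i) (L2.integrable_inner (𝕜 := ℝ) f g).aestronglyMeasurable]
    simp [mul_comm]
  | succ k ih =>
    rw [← add_assoc, integral_mul_eval_succ hsnd f g (Nat.le_add_right i k), ih, pow_succ,
      mul_apply_eq_comp]

/-- Adding the term of index `j` raises the second moment by the lag-zero covariance plus twice
those of lags `1` to `j`. Summing these increments makes the scaled variance a Cesàro mean. -/
theorem integral_sum_eval_sq (hsnd : MeasurePreserving Prod.snd (μ ⊗ₘ P) μ) (h : Lp ℝ 2 μ)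
    (n : ℕ) :
    ∫ x, (∑ i ∈ Finset.range n, h (x i)) ^ 2 ∂(chainLaw P μ) =
      ∑ j ∈ Finset.range n,
        (2 * ∑ k ∈ Finset.range (j + 1), inner ℝ h ((transitionOp hsnd ^ k) h) -
          inner ℝ h h) := by
  have hm (i : ℕ) : MemLp (fun x : ℕ → S => h (x i)) 2 (chainLaw P μ) :=
    (Lp.memLp h).comp_measurePreserving (measurePreserving_eval hsnd i)
  have hS (n : ℕ) : MemLp (fun x : ℕ → S => ∑ i ∈ Finset.range n, h (x i)) 2 (chainLaw P μ) :=
    memLp_finsetSum _ fun i _ => hm i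
  induction n with
  | zero => simp
  | succ n ih =>
    have hexp (x : ℕ → S) : (∑ i ∈ Finset.range (n + 1), h (x i)) ^ 2 =
        (∑ i ∈ Finset.range n, h (x i)) ^ 2 +
          (2 * ∑ i ∈ Finset.range n, h (x i) * h (x n) + h (x n) * h (x n)) := by
      rw [Finset.sum_range_succ, ← Finset.sum_mul]; ring
    have hi (i : ℕ) : Integrable (fun x : ℕ → S => h (x i) * h (x n)) (chainLaw P μ) :=
      (hm i).integrable_mul (hm n)
    have hsum : Integrable (fun x : ℕ → S => ∑ i ∈ Finset.range n, h (x i) * h (x n))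
        (chainLaw P μ) := integrable_finsetSum _ fun i _ => hi i
    simp_rw [hexp]
    have hrest : Integrable (fun x : ℕ → S => 2 * ∑ i ∈ Finset.range n, h (x i) * h (x n) +
        h (x n) * h (x n)) (chainLaw P μ) := (hsum.const_mul 2).add (hi n)
    rw [integral_add (hS n).integrable_sq hrest,
      integral_add (hsum.const_mul 2) (hi n), integral_const_mul,
      integral_finsetSum _ fun i _ => hi i, ih, Finset.sum_range_succ _ n]
    have hcov : ∑ i ∈ Finset.range n, ∫ x, h (x i) * h (x n) ∂(chainLaw P μ) =
        ∑ k ∈ Finset.range n, inner ℝ h ((transitionOp hsnd ^ (k + 1)) h) := by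
      -- Reversing the order turns the index `i` into the lag `n - i`, running over `1, …, n`.
      rw [← Finset.sum_range_reflect (fun i => ∫ x, h (x i) * h (x n) ∂(chainLaw P μ)) n]
      refine Finset.sum_congr rfl fun i hi => ?_
      have hin : i < n := Finset.mem_range.1 hi
      rw [← integral_mul_eval_add hsnd h h (n - 1 - i) (i + 1)]
      have : n - 1 - i + (i + 1) = n := by omega
      rw [this]
    have h0 := integral_mul_eval_add hsnd h h n 0
    simp only [add_zero, pow_zero, one_apply_eq_self] at h0
    rw [hcov, h0, Finset.sum_range_succ' _ n, pow_zero, one_apply_eq_self]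
    ring

theorem scaledVariance_eq (hsnd : MeasurePreserving Prod.snd (μ ⊗ₘ P) μ) {h : S → ℝ}
    (hL2 : MemLp h 2 μ) (hmean : ∫ x, h x ∂μ = 0) {n : ℕ} (hn : n ≠ 0) :
    scaledVariance P μ h n = ENNReal.ofReal ((n : ℝ)⁻¹ * ∑ j ∈ Finset.range n,
        (2 * ∑ k ∈ Finset.range (j + 1),
          inner ℝ (hL2.toLp h) ((transitionOp hsnd ^ k) (hL2.toLp h)) -
          inner ℝ (hL2.toLp h) (hL2.toLp h))) := by
  have hm (i : ℕ) : MemLp (fun x : ℕ → S => h (x i)) 2 (chainLaw P μ) :=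
    hL2.comp_measurePreserving (measurePreserving_eval hsnd i)
  have hS : MemLp (fun x : ℕ → S => ∑ i ∈ Finset.range n, h (x i)) 2 (chainLaw P μ) :=
    memLp_finsetSum _ fun i _ => hm i
  have hmean' : ∫ x, ∑ i ∈ Finset.range n, h (x i) ∂(chainLaw P μ) = 0 := by
    rw [integral_finsetSum _ fun i _ => (hm i).integrable one_le_two]
    exact Finset.sum_eq_zero fun i _ =>
      (integral_comp_measurePreserving (measurePreserving_eval hsnd i) hL2.1).trans hmean
  have hcongr : ∫ x, (∑ i ∈ Finset.range n, h (x i)) ^ 2 ∂(chainLaw P μ) =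
      ∫ x, (∑ i ∈ Finset.range n, hL2.toLp h (x i)) ^ 2 ∂(chainLaw P μ) := by
    refine integral_congr_ae ?_
    have hae : ∀ᵐ x ∂(chainLaw P μ), ∀ i, hL2.toLp h (x i) = h (x i) :=
      ae_all_iff.2 fun i => (measurePreserving_eval hsnd i).quasiMeasurePreserving.ae_eq_comp
        hL2.coeFn_toLp
    filter_upwards [hae] with x hx
    simp only [hx]
  rw [scaledVariance, evariance_mul, ← ofReal_variance hS,
    variance_of_integral_eq_zero hS.1.aemeasurable hmean', hcongr,
    integral_sum_eval_sq hsnd, ← ENNReal.ofReal_mul (sq_nonneg _), ← ENNReal.ofReal_natCast,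
    ← ENNReal.ofReal_mul (Nat.cast_nonneg n), ← mul_assoc]
  congr 2
  have : (n : ℝ) ≠ 0 := Nat.cast_ne_zero.2 hn
  field_simp

end Covariance

/-! ### Asymptotic variance of a reversible chain with a left spectral gap -/

section ReversibleChain

variable {S : Type*} [MeasurableSpace S] {μ : Measure S}

theorem norm_toLp_sq {f : S → ℝ} (hf : MemLp f 2 μ) : ‖hf.toLp f‖ ^ 2 = ∫ x, f x ^ 2 ∂μ := by
  rw [← real_inner_self_eq_norm_sq, L2.inner_def]
  refine integral_congr_ae ?_
  filter_upwards [hf.coeFn_toLp] with x hx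
  rw [hx]
  simp [sq]

theorem inner_toLp {f g : S → ℝ} (hf : MemLp f 2 μ) (hg : MemLp g 2 μ) :
    inner ℝ (hf.toLp f) (hg.toLp g) = ∫ x, f x * g x ∂μ := by
  rw [L2.inner_def]
  refine integral_congr_ae ?_
  filter_upwards [hf.coeFn_toLp, hg.coeFn_toLp] with x hx hx'
  rw [hx, hx']
  simp [mul_comm]

variable {P : Kernel S S} [IsMarkovKernel P] [IsProbabilityMeasure μ]

theorem inner_toLp_transitionOp (hsnd : MeasurePreserving Prod.snd (μ ⊗ₘ P) μ) {f g : S → ℝ}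
    (hf : MemLp f 2 μ) (hg : MemLp g 2 μ) :
    inner ℝ (hf.toLp f) (transitionOp hsnd (hg.toLp g)) = ∫ z, f z.1 * g z.2 ∂(μ ⊗ₘ P) := by
  rw [inner_transitionOp]
  exact integral_congr_ae
    (((measurePreserving_fst_compProd (P := P)).quasiMeasurePreserving.ae_eq_comp
      hf.coeFn_toLp).mul (hsnd.quasiMeasurePreserving.ae_eq_comp hg.coeFn_toLp))

theorem abs_integral_mul_compProd_le (hsnd : MeasurePreserving Prod.snd (μ ⊗ₘ P) μ) {f : S → ℝ}
    (hf : MemLp f 2 μ) : |∫ z, f z.1 * f z.2 ∂(μ ⊗ₘ P)| ≤ ∫ x, f x ^ 2 ∂μ := by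
  rw [← inner_toLp_transitionOp hsnd hf hf, ← norm_toLp_sq hf, sq]
  exact (abs_real_inner_le_norm _ _).trans (by gcongr; exact norm_transitionOp_apply_le hsnd _)

theorem leftSpectralGap_le (hsnd : MeasurePreserving Prod.snd (μ ⊗ₘ P) μ) {f : S → ℝ}
    (hf : MemLp f 2 μ) (hf0 : ∫ x, f x ∂μ = 0) (hf1 : ∫ x, f x ^ 2 ∂μ = 1) :
    leftSpectralGap P μ ≤ 1 + ∫ z, f z.1 * f z.2 ∂(μ ⊗ₘ P) := by
  rw [leftSpectralGap]
  gcongr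
  refine csInf_le ⟨-1, ?_⟩ ⟨f, hf, hf0, hf1, rfl⟩
  rintro _ ⟨g, hg, -, hg1, rfl⟩
  have := abs_integral_mul_compProd_le hsnd hg
  rw [hg1] at this
  exact (abs_le.1 this).1

theorem leftSpectralGap_le_two (hsnd : MeasurePreserving Prod.snd (μ ⊗ₘ P) μ) :
    leftSpectralGap P μ ≤ 2 := by
  by_cases hne : ∃ f : S → ℝ, MemLp f 2 μ ∧ ∫ x, f x ∂μ = 0 ∧ ∫ x, f x ^ 2 ∂μ = 1
  · obtain ⟨f, hf, hf0, hf1⟩ := hne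
    have h1 := leftSpectralGap_le hsnd hf hf0 hf1
    have h2 := abs_integral_mul_compProd_le hsnd hf
    rw [hf1] at h2
    linarith [(abs_le.1 h2).2]
  -- With no centred function of norm one, the infimum of the empty set is `0` by convention and the
  -- gap is `1`.
  · have hempty : {c : ℝ | ∃ f : S → ℝ, MemLp f 2 μ ∧ ∫ x, f x ∂μ = 0 ∧ ∫ x, f x ^ 2 ∂μ = 1 ∧
        c = ∫ z, f z.1 * f z.2 ∂(μ ⊗ₘ P)} = ∅ := by
      rw [Set.eq_empty_iff_forall_notMem]
      rintro _ ⟨f, hf, hf0, hf1, -⟩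
      exact hne ⟨f, hf, hf0, hf1⟩
    rw [leftSpectralGap, hempty, Real.sInf_empty]
    norm_num

theorem leftSpectralGap_mul_le (hsnd : MeasurePreserving Prod.snd (μ ⊗ₘ P) μ) {f : S → ℝ}
    (hf : MemLp f 2 μ) (hf0 : ∫ x, f x ∂μ = 0) :
    leftSpectralGap P μ * ∫ x, f x ^ 2 ∂μ ≤
      ∫ x, f x ^ 2 ∂μ + ∫ z, f z.1 * f z.2 ∂(μ ⊗ₘ P) := by
  set N := ∫ x, f x ^ 2 ∂μ with hN
  have hN0 : 0 ≤ N := integral_nonneg fun x => sq_nonneg _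
  rcases hN0.eq_or_lt with h0 | hpos
  · have := abs_integral_mul_compProd_le hsnd hf
    rw [← hN, ← h0] at this
    rw [← h0]
    linarith [(abs_le.1 this).1]
  · set c := (√N)⁻¹ with hc
    have hcc : c * c = N⁻¹ := by rw [hc, ← mul_inv, Real.mul_self_sqrt hN0]
    have h := leftSpectralGap_le hsnd (f := fun x => c * f x) (hf.const_mul c)
      (by rw [integral_const_mul, hf0, mul_zero])
      (by simp_rw [mul_pow, integral_const_mul, ← hN, sq, hcc]; exact inv_mul_cancel₀ hpos.ne')
    have hmul : ∫ z, c * f z.1 * (c * f z.2) ∂(μ ⊗ₘ P) =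
        N⁻¹ * ∫ z, f z.1 * f z.2 ∂(μ ⊗ₘ P) := by
      rw [← integral_const_mul, ← hcc]
      congr 1 with z
      ring
    rw [hmul] at h
    calc leftSpectralGap P μ * N ≤ (1 + N⁻¹ * ∫ z, f z.1 * f z.2 ∂(μ ⊗ₘ P)) * N := by gcongr
      _ = N + ∫ z, f z.1 * f z.2 ∂(μ ⊗ₘ P) := by
        field_simp

theorem integral_transitionOp (hsnd : MeasurePreserving Prod.snd (μ ⊗ₘ P) μ) (f : Lp ℝ 2 μ) :
    ∫ x, transitionOp hsnd f x ∂μ = ∫ x, f x ∂μ := by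
  have hint : Integrable (fun z : S × S => f z.2) (μ ⊗ₘ P) :=
    ((Lp.memLp f).comp_measurePreserving hsnd).integrable one_le_two
  rw [integral_congr_ae (coeFn_transitionOp hsnd f), ← Measure.integral_compProd hint]
  exact integral_comp_measurePreserving hsnd (Lp.aestronglyMeasurable f)

theorem integral_transitionOp_pow (hsnd : MeasurePreserving Prod.snd (μ ⊗ₘ P) μ) (f : Lp ℝ 2 μ)
    (k : ℕ) : ∫ x, (transitionOp hsnd ^ k) f x ∂μ = ∫ x, f x ∂μ := by
  induction k with
  | zero => rw [pow_zero, one_apply_eq_self]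
  | succ k ih => rw [pow_succ', mul_apply_eq_comp, integral_transitionOp, ih]

theorem integral_sub_sq_compProd (hsnd : MeasurePreserving Prod.snd (μ ⊗ₘ P) μ) {g : S → ℝ}
    (hg : MemLp g 2 μ) :
    ∫ z, (g z.1 - g z.2) ^ 2 ∂(μ ⊗ₘ P) =
      2 * (∫ x, g x ^ 2 ∂μ - ∫ z, g z.1 * g z.2 ∂(μ ⊗ₘ P)) := by
  have hfst := measurePreserving_fst_compProd (P := P) (μ := μ)
  have h1 : MemLp (fun z : S × S => g z.1) 2 (μ ⊗ₘ P) := hg.comp_measurePreserving hfst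
  have h2 : MemLp (fun z : S × S => g z.2) 2 (μ ⊗ₘ P) := hg.comp_measurePreserving hsnd
  have e1 : ∫ z, g z.1 ^ 2 ∂(μ ⊗ₘ P) = ∫ x, g x ^ 2 ∂μ :=
    integral_comp_measurePreserving hfst (hg.1.pow 2)
  have e2 : ∫ z, g z.2 ^ 2 ∂(μ ⊗ₘ P) = ∫ x, g x ^ 2 ∂μ :=
    integral_comp_measurePreserving hsnd (hg.1.pow 2)
  have h12 := (integrable_mul_compProd hsnd hg hg).const_mul 2
  have hexp (z : S × S) :
      (g z.1 - g z.2) ^ 2 = g z.1 ^ 2 + g z.2 ^ 2 - 2 * (g z.1 * g z.2) := by ring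
  have hadd : Integrable (fun z : S × S => g z.1 ^ 2 + g z.2 ^ 2) (μ ⊗ₘ P) :=
    h1.integrable_sq.add h2.integrable_sq
  simp_rw [hexp]
  rw [integral_sub hadd h12, integral_add h1.integrable_sq h2.integrable_sq, e1, e2,
    integral_const_mul]
  ring

/-- The asymptotic variance of a reversible chain with positive left spectral gap exists, and is
bounded below through its variational characterisation by the Dirichlet form. -/
theorem exists_hasAsymptoticVariance (hrev : (μ ⊗ₘ P).map Prod.swap = μ ⊗ₘ P)
    (hgap : 0 < leftSpectralGap P μ) {h : S → ℝ} (hL2 : MemLp h 2 μ)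
    (hmean : ∫ x, h x ∂μ = 0) :
    ∃ V : ℝ≥0∞, HasAsymptoticVariance P μ h V ∧ ∀ g : S → ℝ, MemLp g 2 μ →
      ((4 * ∫ x, g x * h x ∂μ - ∫ z, (g z.1 - g z.2) ^ 2 ∂(μ ⊗ₘ P) - ∫ x, h x ^ 2 ∂μ : ℝ) :
        EReal) ≤ V := by
  have hsnd := measurePreserving_snd_compProd hrev
  set T := transitionOp hsnd with hT
  set η := hL2.toLp h with hη
  have horbit (k : ℕ) : leftSpectralGap P μ * ‖(T ^ k) η‖ ^ 2 ≤
      ‖(T ^ k) η‖ ^ 2 + inner ℝ ((T ^ k) η) (T ((T ^ k) η)) := by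
    -- Invariance of `μ` keeps the orbit centred, so the gap is available at each of its points.
    have h0 : ∫ x, (T ^ k) η x ∂μ = 0 := by
      rw [hT, integral_transitionOp_pow, ← hmean]
      exact integral_congr_ae hL2.coeFn_toLp
    have h1 := leftSpectralGap_mul_le hsnd (Lp.memLp ((T ^ k) η)) h0
    rwa [← norm_toLp_sq (Lp.memLp _), Lp.toLp_coeFn, ← inner_transitionOp hsnd] at h1
  have hvar : (fun n : ℕ => ENNReal.ofReal ((n : ℝ)⁻¹ * ∑ j ∈ Finset.range n,
      (2 * ∑ k ∈ Finset.range (j + 1), inner ℝ η ((T ^ k) η) - inner ℝ η η))) =ᶠ[atTop]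
      fun n => scaledVariance P μ h n := by
    filter_upwards [eventually_ne_atTop 0] with n hn
    rw [scaledVariance_eq hsnd hL2 hmean hn]
  rcases tendsto_sum_autocov (transitionOp_symm hsnd hrev) (norm_transitionOp_apply_le hsnd) hgap
    horbit with ⟨L, hL, hLg⟩ | hL
  · refine ⟨ENNReal.ofReal (2 * L - inner ℝ η η), ?_, fun g hg => ?_⟩
    · refine Tendsto.congr' hvar (ENNReal.tendsto_ofReal (Tendsto.cesaro ?_))
      exact ((hL.comp (tendsto_add_atTop_nat 1)).const_mul 2).sub_const _
    · have h1 := hLg (hg.toLp g)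
      rw [inner_sub_right, inner_toLp hg hL2, real_inner_self_eq_norm_sq, norm_toLp_sq hg,
        inner_toLp_transitionOp] at h1
      rw [EReal.coe_ennreal_ofReal, integral_sub_sq_compProd hsnd hg, real_inner_self_eq_norm_sq,
        norm_toLp_sq hL2, EReal.coe_le_coe_iff]
      exact le_max_of_le_left (by linarith)
  · refine ⟨⊤, ?_, fun g _ => by simp⟩
    refine Tendsto.congr' hvar (ENNReal.tendsto_ofReal_atTop.comp (tendsto_cesaro_atTop ?_))
    exact tendsto_atTop_add_const_right _ _
      ((hL.comp (tendsto_add_atTop_nat 1)).const_mul_atTop two_pos)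

end ReversibleChain

/-! ### Metropolis-Hastings kernels -/

section MetropolisHastings

variable {S : Type*} [MeasurableSpace S] {K : Kernel S S} [IsMarkovKernel K]
  {α : S → S → ℝ≥0∞} {μ : Measure S} [IsProbabilityMeasure μ]

theorem measurable_rejection (hα : Measurable (Function.uncurry α)) :
    Measurable (Function.uncurry fun (x : S) (_ : S) => 1 - ∫⁻ y, α x y ∂(K x)) :=
  (measurable_const.sub hα.lintegral_kernel_prod_right).comp measurable_fst

theorem lintegral_compProd_mhKernel (hα : Measurable (Function.uncurry α))
    (hle : ∀ x y, α x y ≤ 1) {F : S × S → ℝ≥0∞} (hF : Measurable F) :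
    ∫⁻ z, F z ∂(μ ⊗ₘ mhKernel K α) =
      ∫⁻ z, α z.1 z.2 * F z ∂(μ ⊗ₘ K) +
        ∫⁻ x, (1 - ∫⁻ y, α x y ∂(K x)) * F (x, x) ∂μ := by
  have := isMarkovKernel_mhKernel K α hα hle
  have hα' : Measurable fun z : S × S => α z.1 z.2 := hα
  have hαF : Measurable fun z : S × S => α z.1 z.2 * F z := hα'.mul hF
  rw [Measure.lintegral_compProd hF, Measure.lintegral_compProd hαF,
    ← lintegral_add_left hαF.lintegral_kernel_prod_right']
  refine lintegral_congr fun x => ?_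
  have hFx : Measurable fun y => F (x, y) := hF.comp measurable_prodMk_left
  rw [mhKernel, FunLike.coe_add, Pi.add_apply, lintegral_add_measure,
    Kernel.lintegral_withDensity _ hα _ hFx,
    Kernel.lintegral_withDensity _ (measurable_rejection hα) _ hFx,
    Kernel.id_apply, lintegral_dirac' _ (by fun_prop)]

/-- Detailed balance on the accepted moves makes a Metropolis-Hastings kernel reversible. -/
theorem map_swap_compProd_mhKernel (hα : Measurable (Function.uncurry α))
    (hle : ∀ x y, α x y ≤ 1)
    (hbal : ∀ F : S × S → ℝ≥0∞, Measurable F →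
      ∫⁻ z, α z.1 z.2 * F z.swap ∂(μ ⊗ₘ K) = ∫⁻ z, α z.1 z.2 * F z ∂(μ ⊗ₘ K)) :
    (μ ⊗ₘ mhKernel K α).map Prod.swap = μ ⊗ₘ mhKernel K α := by
  refine Measure.ext_of_lintegral _ fun F hF => ?_
  have hFs : Measurable fun z : S × S => F z.swap := hF.comp measurable_swap
  rw [lintegral_map hF measurable_swap, lintegral_compProd_mhKernel hα hle hF,
    lintegral_compProd_mhKernel hα hle hFs, hbal F hF]
  -- The rejection part lives on the diagonal, which the swap fixes.
  rfl

theorem enorm_sub_sq_le (a b : ℝ) : ‖(a - b) ^ 2‖ₑ ≤ 2 * (‖a‖ₑ ^ 2 + ‖b‖ₑ ^ 2) := by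
  simp_rw [← enorm_pow, Real.enorm_of_nonneg (sq_nonneg _)]
  rw [← ENNReal.ofReal_add (sq_nonneg _) (sq_nonneg _), ← ENNReal.ofReal_ofNat,
    ← ENNReal.ofReal_mul zero_le_two]
  exact ENNReal.ofReal_le_ofReal (by nlinarith [sq_nonneg (a + b)])

/-- The Dirichlet form of a Metropolis-Hastings kernel is controlled by its acceptance
probability. -/
theorem ofReal_integral_sub_sq_mhKernel_le (hα : Measurable (Function.uncurry α))
    (hle : ∀ x y, α x y ≤ 1)
    (hbal : ∀ F : S × S → ℝ≥0∞, Measurable F →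
      ∫⁻ z, α z.1 z.2 * F z.swap ∂(μ ⊗ₘ K) = ∫⁻ z, α z.1 z.2 * F z ∂(μ ⊗ₘ K))
    {g : S → ℝ} (hg : Measurable g) :
    ENNReal.ofReal (∫ z, (g z.1 - g z.2) ^ 2 ∂(μ ⊗ₘ mhKernel K α)) ≤
      4 * ∫⁻ x, ‖g x‖ₑ ^ 2 * ∫⁻ y, α x y ∂(K x) ∂μ := by
  have hα' : Measurable fun z : S × S => α z.1 z.2 := hα
  have hg2 : Measurable fun z : S × S => ‖g z.1‖ₑ ^ 2 := by fun_prop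
  have hαg : Measurable fun z : S × S => α z.1 z.2 * ‖g z.1‖ₑ ^ 2 := hα'.mul hg2
  have hfst : ∫⁻ z, α z.1 z.2 * ‖g z.1‖ₑ ^ 2 ∂(μ ⊗ₘ K) =
      ∫⁻ x, ‖g x‖ₑ ^ 2 * ∫⁻ y, α x y ∂(K x) ∂μ := by
    rw [Measure.lintegral_compProd hαg]
    refine lintegral_congr fun x => ?_
    have hαx : Measurable fun y => α x y := hα'.comp measurable_prodMk_left
    exact (lintegral_mul_const (‖g x‖ₑ ^ 2) hαx).trans (mul_comm _ _)
  -- Passing to the extended integral avoids any integrability assumption on `g`. The rejection term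
  -- then drops out, since the squared difference vanishes on the diagonal, and detailed balance
  -- merges the two squares.
  calc ENNReal.ofReal (∫ z, (g z.1 - g z.2) ^ 2 ∂(μ ⊗ₘ mhKernel K α))
      ≤ ‖∫ z, (g z.1 - g z.2) ^ 2 ∂(μ ⊗ₘ mhKernel K α)‖ₑ := Real.ofReal_le_enorm _
    _ ≤ ∫⁻ z, ‖(g z.1 - g z.2) ^ 2‖ₑ ∂(μ ⊗ₘ mhKernel K α) := enorm_integral_le_lintegral_enorm _
    _ = ∫⁻ z, α z.1 z.2 * ‖(g z.1 - g z.2) ^ 2‖ₑ ∂(μ ⊗ₘ K) := by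
      rw [lintegral_compProd_mhKernel hα hle (by fun_prop)]
      simp
    _ ≤ ∫⁻ z, 2 * (α z.1 z.2 * ‖g z.1‖ₑ ^ 2 + α z.1 z.2 * ‖g z.2‖ₑ ^ 2) ∂(μ ⊗ₘ K) := by
      refine lintegral_mono fun z => ?_
      rw [← mul_add, mul_left_comm]
      gcongr
      exact enorm_sub_sq_le _ _
    _ = 4 * ∫⁻ x, ‖g x‖ₑ ^ 2 * ∫⁻ y, α x y ∂(K x) ∂μ := by
      have hswap := hbal _ hg2
      simp only [Prod.fst_swap] at hswap
      rw [lintegral_const_mul' _ _ ENNReal.ofNat_ne_top, lintegral_add_left hαg, hswap,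
        hfst, ← two_mul, ← mul_assoc]
      norm_num

end MetropolisHastings

/-! ### The pseudo-marginal kernel -/

namespace PseudoMarginal

variable {Θ : Type*} [MeasurableSpace Θ] {ref : Measure Θ} (M : PseudoMarginal ref)

theorem lintegral_joint [SigmaFinite ref] {F : Θ × ℝ≥0 → ℝ≥0∞} (hF : Measurable F) :
    ∫⁻ x, F x ∂M.joint = ∫⁻ x, M.post x.1 * F x ∂(ref ⊗ₘ M.noise) := by
  have hp := M.measurable_post
  rw [joint, Measure.lintegral_compProd hF, target,
    lintegral_withDensity_eq_lintegral_mul _ hp.coe_nnreal_ennreal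
      hF.lintegral_kernel_prod_right', Measure.lintegral_compProd (by fun_prop)]
  refine lintegral_congr fun θ => ?_
  exact (lintegral_const_mul _ (hF.comp measurable_prodMk_left)).symm

theorem lintegral_stationary (F : Θ × ℝ≥0 → ℝ≥0∞) :
    ∫⁻ x, F x ∂M.stationary = ∫⁻ x, x.2 * F x ∂M.joint := by
  rw [stationary, lintegral_withDensity_eq_lintegral_mul_non_measurable _ (by fun_prop)
    (ae_of_all _ fun x => ENNReal.coe_lt_top)]
  rfl

/-- The density of the flow of accepted moves with respect to the square of `ref ⊗ₘ M.noise`. -/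
noncomputable def flow (x y : Θ × ℝ≥0) : ℝ≥0∞ :=
  min ((M.post x.1 : ℝ≥0∞) * x.2 * M.q x.1 y.1) ((M.post y.1 : ℝ≥0∞) * y.2 * M.q y.1 x.1)

theorem flow_comm (x y : Θ × ℝ≥0) : M.flow x y = M.flow y x := min_comm _ _

theorem measurable_flow : Measurable (Function.uncurry M.flow) := by
  have h1 := M.measurable_post
  have h2 : Measurable fun p : (Θ × ℝ≥0) × (Θ × ℝ≥0) => M.q p.1.1 p.2.1 :=
    M.measurable_q.comp (by fun_prop : Measurable
      fun p : (Θ × ℝ≥0) × (Θ × ℝ≥0) => (p.1.1, p.2.1))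
  have h3 : Measurable fun p : (Θ × ℝ≥0) × (Θ × ℝ≥0) => M.q p.2.1 p.1.1 :=
    h2.comp measurable_swap
  unfold Function.uncurry flow
  fun_prop

/-- The factor `π(θ) w q(θ' | θ)` clears the denominator inside the minimum. Where it is zero both
sides vanish, so conventions on division by zero play no role. -/
theorem mul_accept_eq_flow (x y : Θ × ℝ≥0) :
    (M.post x.1 : ℝ≥0∞) * x.2 * (M.q x.1 y.1 * M.accept x y) = M.flow x y := by
  rw [accept, flow, ratio, ← mul_assoc]
  by_cases h0 : (M.post x.1 : ℝ≥0∞) * x.2 * M.q x.1 y.1 = 0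
  · rw [h0, zero_mul, min_eq_left zero_le]
  · have htop : (M.post x.1 : ℝ≥0∞) * x.2 * M.q x.1 y.1 ≠ ⊤ := by finiteness
    rw [mul_min_of_nonneg _ _ zero_le, mul_one]
    congr 1
    have hpq : (M.post x.1 : ℝ≥0∞) * M.q x.1 y.1 ≠ 0 := fun h => h0 (by
      rw [mul_right_comm, h, zero_mul])
    have hw : (x.2 : ℝ≥0∞) ≠ 0 := fun h => h0 (by rw [h, mul_zero, zero_mul])
    calc (M.post x.1 : ℝ≥0∞) * x.2 * M.q x.1 y.1 * ((M.post y.1 : ℝ≥0∞) * M.q y.1 x.1 /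
          ((M.post x.1 : ℝ≥0∞) * M.q x.1 y.1) * (y.2 / x.2))
        = (((M.post x.1 : ℝ≥0∞) * M.q x.1 y.1) / ((M.post x.1 : ℝ≥0∞) * M.q x.1 y.1)) *
          ((x.2 : ℝ≥0∞) / x.2) * ((M.post y.1 : ℝ≥0∞) * y.2 * M.q y.1 x.1) := by
          simp only [div_eq_mul_inv]; ring
      _ = (M.post y.1 : ℝ≥0∞) * y.2 * M.q y.1 x.1 := by
          rw [ENNReal.div_self hpq (by finiteness), ENNReal.div_self hw (by finiteness), one_mul,
            one_mul]

variable [SigmaFinite ref]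

theorem lintegral_propose {F : Θ → ℝ≥0∞} (hF : Measurable F) (θ : Θ) :
    ∫⁻ θ', F θ' ∂(M.propose θ) = ∫⁻ θ', M.q θ θ' * F θ' ∂ref := by
  rw [propose, Kernel.lintegral_withDensity _ M.measurable_q.coe_nnreal_ennreal _ hF]
  rfl

theorem lintegral_pmPropose {F : Θ × ℝ≥0 → ℝ≥0∞} (hF : Measurable F) (x : Θ × ℝ≥0) :
    ∫⁻ y, F y ∂(M.pmPropose x) = ∫⁻ θ', ∫⁻ w, F (θ', w) ∂(M.noise θ') ∂(M.propose x.1) := by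
  rw [pmPropose, Kernel.comap_apply, Kernel.lintegral_compProd _ _ _ hF]
  rfl

theorem lintegral_pmPropose_eq_lintegral_compProd {F : Θ × ℝ≥0 → ℝ≥0∞} (hF : Measurable F)
    (x : Θ × ℝ≥0) :
    ∫⁻ y, F y ∂(M.pmPropose x) = ∫⁻ y, M.q x.1 y.1 * F y ∂(ref ⊗ₘ M.noise) := by
  have hq : Measurable fun y : Θ × ℝ≥0 => M.q x.1 y.1 :=
    M.measurable_q.comp (measurable_const.prodMk measurable_fst)
  rw [M.lintegral_pmPropose hF, M.lintegral_propose hF.lintegral_kernel_prod_right',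
    Measure.lintegral_compProd (by fun_prop)]
  refine lintegral_congr fun θ => ?_
  exact (lintegral_const_mul _ (hF.comp measurable_prodMk_left)).symm

theorem lintegral_accept_mul {F : (Θ × ℝ≥0) × (Θ × ℝ≥0) → ℝ≥0∞} (hF : Measurable F) :
    ∫⁻ z, M.accept z.1 z.2 * F z ∂(M.stationary ⊗ₘ M.pmPropose) =
      ∫⁻ x, ∫⁻ y, M.flow x y * F (x, y) ∂(ref ⊗ₘ M.noise) ∂(ref ⊗ₘ M.noise) := by
  have hα : Measurable fun z : (Θ × ℝ≥0) × (Θ × ℝ≥0) => M.accept z.1 z.2 := M.measurable_accept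
  have hαF : Measurable fun z : (Θ × ℝ≥0) × (Θ × ℝ≥0) => M.accept z.1 z.2 * F z := hα.mul hF
  have hin : Measurable fun x : Θ × ℝ≥0 =>
      (x.2 : ℝ≥0∞) * ∫⁻ y, M.accept x y * F (x, y) ∂(M.pmPropose x) :=
    (by fun_prop : Measurable fun x : Θ × ℝ≥0 => (x.2 : ℝ≥0∞)).mul
      hαF.lintegral_kernel_prod_right'
  rw [Measure.lintegral_compProd hαF, lintegral_stationary, lintegral_joint _ hin]
  refine lintegral_congr fun x => ?_
  have hx : Measurable fun y : Θ × ℝ≥0 => M.accept x y * F (x, y) :=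
    (M.measurable_accept.comp measurable_prodMk_left).mul (hF.comp measurable_prodMk_left)
  have hq : Measurable fun y : Θ × ℝ≥0 => M.q x.1 y.1 :=
    M.measurable_q.comp (measurable_const.prodMk measurable_fst)
  have hqx : Measurable fun y : Θ × ℝ≥0 =>
      (M.q x.1 y.1 : ℝ≥0∞) * (M.accept x y * F (x, y)) := hq.coe_nnreal_ennreal.mul hx
  rw [M.lintegral_pmPropose_eq_lintegral_compProd hx, ← mul_assoc]
  refine (lintegral_const_mul ((M.post x.1 : ℝ≥0∞) * x.2) hqx).symm.trans
    (lintegral_congr fun y => ?_)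
  rw [← M.mul_accept_eq_flow]
  simp only [mul_assoc]

/-- Detailed balance: relative to the square of `ref ⊗ₘ M.noise` the accepted flow has a symmetric
density, and Tonelli exchanges the two variables. -/
theorem lintegral_accept_mul_swap (F : (Θ × ℝ≥0) × (Θ × ℝ≥0) → ℝ≥0∞) (hF : Measurable F) :
    ∫⁻ z, M.accept z.1 z.2 * F z.swap ∂(M.stationary ⊗ₘ M.pmPropose) =
      ∫⁻ z, M.accept z.1 z.2 * F z ∂(M.stationary ⊗ₘ M.pmPropose) := by
  have hFs : Measurable fun z : (Θ × ℝ≥0) × (Θ × ℝ≥0) => F z.swap := hF.comp measurable_swap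
  rw [M.lintegral_accept_mul hF, M.lintegral_accept_mul hFs,
    lintegral_lintegral_swap]
  · simp_rw [M.flow_comm, Prod.swap_prod_mk]
  · exact (M.measurable_flow.mul hFs).aemeasurable

/-- The acceptance probability at `(θ, w)` is at most `r(θ) / w`. -/
theorem lintegral_accept_le (x : Θ × ℝ≥0) :
    ∫⁻ y, M.accept x y ∂(M.pmPropose x) ≤ M.meanRatio x.1 / x.2 := by
  have hr : Measurable fun θ' => M.ratio x.1 θ' := M.measurable_ratio.comp measurable_prodMk_left
  have hac : M.propose x.1 ≪ ref := by
    have := Kernel.withDensity_absolutelyContinuous (κ := Kernel.const Θ ref)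
      (f := fun θ θ' => (M.q θ θ' : ℝ≥0∞)) x.1
    rwa [Kernel.const_apply] at this
  -- Unbiasedness is only known where the posterior density is positive. Elsewhere the ratio `r(θ,
  -- θ')` vanishes, so the noise there does not matter.
  have hnoise : ∀ᵐ θ' ∂(M.propose x.1), (M.post θ' : ℝ≥0∞) ≠ 0 →
      ∫⁻ w, (w : ℝ≥0∞) ∂(M.noise θ') = 1 :=
    hac.ae_le ((ae_withDensity_iff M.measurable_post.coe_nnreal_ennreal).1 M.lintegral_noise)
  calc ∫⁻ y, M.accept x y ∂(M.pmPropose x)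
      ≤ ∫⁻ y, M.ratio x.1 y.1 * ((y.2 : ℝ≥0∞) / x.2) ∂(M.pmPropose x) :=
        lintegral_mono fun y => min_le_right _ _
    _ = ∫⁻ θ', M.ratio x.1 θ' * ((∫⁻ w, (w : ℝ≥0∞) ∂(M.noise θ')) / x.2) ∂(M.propose x.1) := by
      rw [M.lintegral_pmPropose (by fun_prop)]
      refine lintegral_congr fun θ' => ?_
      have hw : Measurable fun w : ℝ≥0 => (w : ℝ≥0∞) := by fun_prop
      simp_rw [div_eq_mul_inv]
      rw [lintegral_const_mul _ (hw.mul_const _), lintegral_mul_const _ hw]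
    _ = ∫⁻ θ', M.ratio x.1 θ' * (x.2 : ℝ≥0∞)⁻¹ ∂(M.propose x.1) := by
      refine lintegral_congr_ae ?_
      filter_upwards [hnoise] with θ' hθ'
      by_cases h0 : (M.post θ' : ℝ≥0∞) = 0
      · simp [ratio, h0]
      · rw [hθ' h0, one_div]
    _ = M.meanRatio x.1 / x.2 := by
      rw [lintegral_mul_const _ hr, div_eq_mul_inv, meanRatio]

theorem measurable_meanRatio : Measurable M.meanRatio :=
  M.measurable_ratio.lintegral_kernel_prod_right

end PseudoMarginal

/-! ### Acceptance bound and test functions -/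

namespace PseudoMarginal

variable {Θ : Type*} [MeasurableSpace Θ] {ref : Measure Θ} (M : PseudoMarginal ref)
  [SigmaFinite ref]

/-- The factor `1 ∨ (w / r(θ))`, whose inverse bounds the acceptance probability at `(θ, w)`. -/
noncomputable def sojourn (x : Θ × ℝ≥0) : ℝ≥0∞ := max 1 (x.2 / M.meanRatio x.1)

theorem measurable_sojourn : Measurable M.sojourn := by
  have := M.measurable_meanRatio
  unfold sojourn
  fun_prop

theorem lintegral_accept_le_inv_sojourn (x : Θ × ℝ≥0) :
    ∫⁻ y, M.accept x y ∂(M.pmPropose x) ≤ (M.sojourn x)⁻¹ := by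
  rw [ENNReal.le_inv_iff_le_inv, sojourn, max_le_iff]
  constructor
  · rw [ENNReal.one_le_inv]
    exact (lintegral_mono fun y => min_le_left _ _).trans (by simp)
  · rw [ENNReal.le_inv_iff_le_inv]
    -- At `w = 0` the quotient `w / r(θ)` is `0` and its inverse is infinite, whereas `r(θ) / w`
    -- would be `0` if `r(θ) = 0`.
    rcases eq_or_ne (x.2 : ℝ≥0∞) 0 with hw | hw
    · simp [hw]
    · rw [ENNReal.inv_div (Or.inr ENNReal.coe_ne_top) (Or.inr hw)]
      exact M.lintegral_accept_le x

theorem pmKernel_reversible :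
    (M.stationary ⊗ₘ M.pmKernel).map Prod.swap = M.stationary ⊗ₘ M.pmKernel :=
  map_swap_compProd_mhKernel M.measurable_accept (fun _ _ => min_le_left _ _)
    M.lintegral_accept_mul_swap

/-- Test functions for the variational lower bound, obtained by truncating `h / (2 α)` where
`1 / α` is the sojourn factor. -/
theorem exists_testFunction {h : Θ × ℝ≥0 → ℝ} (hmeas : Measurable h)
    (hL2 : MemLp h 2 M.stationary) (N : ℕ) :
    ∃ g : Θ × ℝ≥0 → ℝ, MemLp g 2 M.stationary ∧
      ∫⁻ x, ‖h x‖ₑ ^ 2 * min (M.sojourn x) N ∂M.stationary ≤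
        ENNReal.ofReal (4 * ∫ x, g x * h x ∂M.stationary -
          ∫ z, (g z.1 - g z.2) ^ 2 ∂(M.stationary ⊗ₘ M.pmKernel)) := by
  have hs := M.measurable_sojourn
  have hfin (x : Θ × ℝ≥0) : min (M.sojourn x) N ≠ ⊤ :=
    (min_le_right _ _).trans_lt (ENNReal.natCast_lt_top N) |>.ne
  set m : Θ × ℝ≥0 → ℝ := fun x => (min (M.sojourn x) N).toReal with hm
  have hm0 (x : Θ × ℝ≥0) : 0 ≤ m x := ENNReal.toReal_nonneg
  have hmN (x : Θ × ℝ≥0) : m x ≤ N :=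
    ENNReal.toReal_le_of_le_ofReal (Nat.cast_nonneg N) (by simp)
  have hmm : Measurable m := by fun_prop
  have hme (x : Θ × ℝ≥0) : ‖m x‖ₑ = min (M.sojourn x) N := by
    rw [Real.enorm_of_nonneg (hm0 x), ENNReal.ofReal_toReal (hfin x)]
  set k : Θ × ℝ≥0 → ℝ := fun x => h x * m x with hk
  have hkL2 : MemLp k 2 M.stationary := by
    refine (hL2.const_mul (N : ℝ)).of_le (hmeas.mul hmm).aestronglyMeasurable
      (ae_of_all _ fun x => ?_)
    rw [norm_mul, norm_mul, mul_comm, Real.norm_of_nonneg (hm0 x), Real.norm_natCast]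
    gcongr
    exact hmN x
  have hkh : Integrable (fun x => k x * h x) M.stationary := hkL2.integrable_mul hL2
  have hkh0 (x : Θ × ℝ≥0) : 0 ≤ k x * h x := by
    have : k x * h x = h x ^ 2 * m x := by rw [hk]; ring
    rw [this]
    exact mul_nonneg (sq_nonneg _) (hm0 x)
  set B := ∫⁻ x, ‖h x‖ₑ ^ 2 * min (M.sojourn x) N ∂M.stationary with hB
  have hBeq : B = ENNReal.ofReal (∫ x, k x * h x ∂M.stationary) := by
    rw [ofReal_integral_eq_lintegral_ofReal hkh (ae_of_all _ fun x => ?_), hB]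
    · refine lintegral_congr fun x => ?_
      rw [← hme, ← enorm_pow, ← enorm_mul, Real.enorm_of_nonneg
        (mul_nonneg (sq_nonneg _) (hm0 x)), hk]
      ring_nf
    · exact hkh0 x
  have hI0 : 0 ≤ ∫ x, k x * h x ∂M.stationary := integral_nonneg hkh0
  have hD : ∫ z, (k z.1 - k z.2) ^ 2 ∂(M.stationary ⊗ₘ M.pmKernel) ≤
      4 * ∫ x, k x * h x ∂M.stationary := by
    rw [← ENNReal.ofReal_le_ofReal_iff (by positivity), ENNReal.ofReal_mul zero_le_four, ← hBeq]
    refine (ofReal_integral_sub_sq_mhKernel_le M.measurable_accept (fun _ _ => min_le_left _ _)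
      M.lintegral_accept_mul_swap (hmeas.mul hmm)).trans ?_
    rw [ENNReal.ofReal_ofNat]
    gcongr
    refine lintegral_mono fun x => ?_
    change ‖h x * m x‖ₑ ^ 2 * _ ≤ _
    rw [enorm_mul, mul_pow, hme, mul_assoc]
    gcongr
    -- One factor of the truncated sojourn cancels the acceptance probability; `s * s⁻¹ ≤ 1`
    -- persists when `s = ∞`.
    calc min (M.sojourn x) N ^ 2 * ∫⁻ y, M.accept x y ∂(M.pmPropose x)
        ≤ min (M.sojourn x) N * (M.sojourn x * (M.sojourn x)⁻¹) := by
          rw [sq, mul_assoc]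
          gcongr
          · exact min_le_left _ _
          · exact M.lintegral_accept_le_inv_sojourn x
      _ ≤ min (M.sojourn x) N := mul_le_of_le_one_right' (ENNReal.mul_inv_le_one _)
  -- For `g = t k` the lower bound is `(4 t - 4 t²) ∫ k h`, largest at `t = 1 / 2`.
  refine ⟨fun x => 1 / 2 * k x, hkL2.const_mul _, ?_⟩
  have h1 (x : Θ × ℝ≥0) : 1 / 2 * k x * h x = 1 / 2 * (k x * h x) := by ring
  have h2 (z : (Θ × ℝ≥0) × (Θ × ℝ≥0)) :
      (1 / 2 * k z.1 - 1 / 2 * k z.2) ^ 2 = 1 / 4 * (k z.1 - k z.2) ^ 2 := by ring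
  simp_rw [h1, h2, integral_const_mul]
  rw [hBeq]
  exact ENNReal.ofReal_le_ofReal (by linarith)

/-- Monotone convergence removes the truncation, including where the sojourn factor is infinite. -/
theorem iSup_lintegral_min_sojourn {h : Θ × ℝ≥0 → ℝ} (hmeas : Measurable h) :
    ⨆ N : ℕ, ∫⁻ x, ‖h x‖ₑ ^ 2 * min (M.sojourn x) N ∂M.stationary =
      ∫⁻ x, ‖h x‖ₑ ^ 2 * M.sojourn x ∂M.stationary := by
  have hs := M.measurable_sojourn
  rw [← lintegral_iSup (fun N => by fun_prop)]
  · refine lintegral_congr fun x => ?_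
    rw [← ENNReal.mul_iSup, ← inf_iSup_eq, ENNReal.iSup_natCast, inf_top_eq]
  · intro N N' hN x
    dsimp only
    gcongr

/-- One factor `w` is the density of the stationary law. As that density is finite, `F` need not be
measurable, so the original `h` is allowed. -/
theorem lintegral_joint_eq_lintegral_stationary (F : Θ × ℝ≥0 → ℝ≥0∞) :
    ∫⁻ x, F x * ((x.2 : ℝ≥0∞) ^ 2 / M.meanRatio x.1) ∂M.joint =
      ∫⁻ x, F x * (x.2 / M.meanRatio x.1) ∂M.stationary := by
  rw [M.lintegral_stationary]
  refine lintegral_congr fun x => ?_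
  simp only [div_eq_mul_inv]
  ring

end PseudoMarginal

/-! ### Combining the two lower bounds -/

theorem ofReal_integral_sq {S : Type*} [MeasurableSpace S] {μ : Measure S} {h : S → ℝ}
    (hL2 : MemLp h 2 μ) : ENNReal.ofReal (∫ x, h x ^ 2 ∂μ) = ∫⁻ x, ‖h x‖ₑ ^ 2 ∂μ := by
  rw [ofReal_integral_eq_lintegral_ofReal hL2.integrable_sq (ae_of_all _ fun x => sq_nonneg _)]
  exact lintegral_congr fun x => by
    rw [← enorm_pow, Real.enorm_of_nonneg (sq_nonneg _)]

/-- For `ε < 2`, average the two bounds; `-1 / ε` enters only through `1 / 2 ≤ 1 / ε`. At `ε = 2`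
division by zero gives `ε / (4 - 2 ε) = 0`, and half of `B - H`, which is nonnegative, is enough. -/
theorem gap_combination_le {ε H A B v : ℝ} (hε : 0 < ε) (hε2 : ε ≤ 2) (hH : 0 ≤ H) (hA : A ≤ B)
    (hHB : H ≤ B) (hBv : B - H ≤ v) (hgap : ε < 2 → ε / (2 - ε) * H ≤ v) :
    (-(1 / ε) + ε / (4 - 2 * ε)) * H + 1 / 2 * A ≤ v := by
  have h1 : 1 / 2 ≤ 1 / ε := one_div_le_one_div_of_le hε hε2
  have h2 : 1 / 2 * H ≤ 1 / ε * H := mul_le_mul_of_nonneg_right h1 hH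
  rcases hε2.lt_or_eq with hlt | rfl
  · have h3 := hgap hlt
    have h4 : ε / (4 - 2 * ε) = 1 / 2 * (ε / (2 - ε)) := by
      have : 2 - ε ≠ 0 := by linarith
      rw [show 4 - 2 * ε = 2 * (2 - ε) by ring]
      field_simp
    rw [h4]
    linarith
  · norm_num
    linarith

theorem theorem2 {Θ : Type*} [MeasurableSpace Θ] (ref : Measure Θ) [SigmaFinite ref]
    (M : PseudoMarginal ref) (ε : ℝ)
    (hgap : leftSpectralGap M.pmKernel M.stationary = ε) (hε : 0 < ε)
    (h : Θ × ℝ≥0 → ℝ) (hL2 : MemLp h 2 M.stationary) (hmean : ∫ x, h x ∂M.stationary = 0) :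
    ∃ V : ℝ≥0∞, HasAsymptoticVariance M.pmKernel M.stationary h V ∧
      (((-(1 / ε) + ε / (4 - 2 * ε)) * ∫ x, h x ^ 2 ∂M.stationary : ℝ) : EReal)
        + (((1 / 2) * ∫⁻ x, ‖h x‖ₑ ^ 2 * ((x.2 : ℝ≥0∞) ^ 2 / M.meanRatio x.1) ∂M.joint :
            ℝ≥0∞) : EReal)
      ≤ (V : EReal) := by
  have hsnd := measurePreserving_snd_compProd M.pmKernel_reversible
  obtain ⟨V, hV, hVg⟩ := exists_hasAsymptoticVariance M.pmKernel_reversible (hgap ▸ hε) hL2 hmean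
  refine ⟨V, hV, ?_⟩
  rcases eq_or_ne V ⊤ with rfl | hVtop
  · simp
  lift V to ℝ≥0 using hVtop
  simp only [EReal.coe_nnreal_eq_coe_real, EReal.coe_le_coe_iff]
    at hVg
  set H := ∫ x, h x ^ 2 ∂M.stationary with hHdef
  have hH0 : 0 ≤ H := integral_nonneg fun x => sq_nonneg _
  -- The Dirichlet form estimate needs a genuinely measurable test function.
  obtain ⟨h', hmeas, hae⟩ := hL2.1.aemeasurable
  have hL2' : MemLp h' 2 M.stationary := hL2.ae_eq hae
  set B := ∫⁻ x, ‖h' x‖ₑ ^ 2 * M.sojourn x ∂M.stationary with hBdef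
  have hBV : B ≤ ENNReal.ofReal (V + H) := by
    rw [hBdef, ← M.iSup_lintegral_min_sojourn hmeas]
    refine iSup_le fun N => ?_
    obtain ⟨g, hg, hle⟩ := M.exists_testFunction hmeas hL2' N
    refine hle.trans (ENNReal.ofReal_le_ofReal ?_)
    have h1 := hVg g hg
    have h2 : ∫ x, g x * h x ∂M.stationary = ∫ x, g x * h' x ∂M.stationary :=
      integral_congr_ae ((ae_eq_refl g).mul hae)
    rw [h2] at h1
    linarith
  have hBtop : B ≠ ⊤ := ne_top_of_le_ne_top ENNReal.ofReal_ne_top hBV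
  have hHB : ENNReal.ofReal H ≤ B := by
    rw [hHdef, ofReal_integral_sq hL2, lintegral_congr_ae (g := fun x => ‖h' x‖ₑ ^ 2)
      (by filter_upwards [hae] with x hx; rw [hx])]
    exact lintegral_mono fun x => le_mul_of_one_le_right' (le_max_left _ _)
  set A := ∫⁻ x, ‖h x‖ₑ ^ 2 * ((x.2 : ℝ≥0∞) ^ 2 / M.meanRatio x.1) ∂M.joint with hAdef
  have hAB : A ≤ B := by
    -- The change of measure precedes the replacement of `h` by `h'`: these agree almost everywhere
    -- for the stationary law, but possibly not for the joint law on `w = 0`.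
    rw [hAdef, M.lintegral_joint_eq_lintegral_stationary fun x => ‖h x‖ₑ ^ 2,
      lintegral_congr_ae (g := fun x => ‖h' x‖ₑ ^ 2 * (x.2 / M.meanRatio x.1))
        (by filter_upwards [hae] with x hx; rw [hx])]
    exact lintegral_mono fun x => mul_le_mul_right (le_max_right _ _) _
  have hAtop : A ≠ ⊤ := ne_top_of_le_ne_top hBtop hAB
  have hA : (((1 / 2) * A : ℝ≥0∞) : EReal) = ((1 / 2 * A.toReal : ℝ) : EReal) := by
    have : (1 / 2) * A ≠ ⊤ := ENNReal.mul_ne_top (by simp) hAtop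
    rw [← ENNReal.ofReal_toReal this, EReal.coe_ennreal_ofReal, max_eq_left ENNReal.toReal_nonneg]
    simp
  rw [hA, EReal.coe_nnreal_eq_coe_real, ← EReal.coe_add,
    EReal.coe_le_coe_iff]
  have hε2 : ε ≤ 2 := hgap ▸ leftSpectralGap_le_two hsnd
  refine gap_combination_le hε hε2 hH0 (ENNReal.toReal_mono hBtop hAB)
    ((ENNReal.ofReal_le_iff_le_toReal hBtop).1 hHB) ?_ fun hlt => ?_
  · have := ENNReal.toReal_le_of_le_ofReal (by positivity) hBV
    linarith
  · have hpos : 0 < 2 - ε := by linarith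
    -- The factor maximises `4 t H - 2 t² (2 - ε) H`, the lower bound for `g = t h`.
    have h1 := hVg (fun x => (2 - ε)⁻¹ * h x) (hL2.const_mul _)
    have h2 := leftSpectralGap_mul_le hsnd hL2 hmean
    have h3 := integral_sub_sq_compProd hsnd hL2
    have h4 (x : Θ × ℝ≥0) : (2 - ε)⁻¹ * h x * h x = (2 - ε)⁻¹ * h x ^ 2 := by ring
    have h5 (z : (Θ × ℝ≥0) × (Θ × ℝ≥0)) : ((2 - ε)⁻¹ * h z.1 - (2 - ε)⁻¹ * h z.2) ^ 2 =
        (2 - ε)⁻¹ ^ 2 * (h z.1 - h z.2) ^ 2 := by ring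
    simp_rw [h4, h5, integral_const_mul] at h1
    rw [hgap] at h2
    have h6 : ∫ z, (h z.1 - h z.2) ^ 2 ∂(M.stationary ⊗ₘ M.pmKernel) ≤ 2 * ((2 - ε) * H) := by
      rw [h3]; linarith
    have h7 : (2 - ε)⁻¹ ^ 2 * ∫ z, (h z.1 - h z.2) ^ 2 ∂(M.stationary ⊗ₘ M.pmKernel) ≤
        2 * ((2 - ε)⁻¹ * H) := by
      calc _ ≤ (2 - ε)⁻¹ ^ 2 * (2 * ((2 - ε) * H)) := by gcongr
        _ = 2 * ((2 - ε)⁻¹ * H) := by field_simp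
    have h8 : ε / (2 - ε) * H = 2 * ((2 - ε)⁻¹ * H) - H := by field_simp; ring
    rw [h8]
    linarith
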